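/- There exists a continuous linear operator $T$ on the complex Hilbert space $\ell^2(\mathbb{N})$ with the following three properties. (i) $T$ is hypercyclic: there is a vector $x$ whose orbit $\{T^n x : n\ge 0\}$ is dense in $\ell^2(\mathbb{N})$. (ii) The set of uniformly recurrent vectors of $T$ is dense in $\ell^2(\mathbb{N})$. Here a vector $x$ is called uniformly recurrent for $T$ if, for every neighbourhood $U$ of $x$, the return set $\{n\ge 0 : T^n x\in U\}$ is syndetic, that is, has bounded gaps: there is some $N\ge 0$ such that every integer interval $[m,m+N]$ with $m\geq 0$ contains an element of the set. (iii) $T$ has no non-zero periodic points: if $T^n x=x$ for some $n\ge 1$, then $x=0$. -/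

import Mathlib

open scoped Topology

namespace LinearDynamics

/-- A set of non-negative integers is syndetic if it has bounded gaps: for some `N`, every
integer interval `[m, m + N]` with `m ≥ 0` meets it. -/
def IsSyndetic (A : Set ℕ) : Prop :=
  ∃ N : ℕ, ∀ m : ℕ, ∃ n ∈ A, m ≤ n ∧ n ≤ m + N

section

variable {X : Type*} [AddCommGroup X] [Module ℂ X] [TopologicalSpace X]

/-- The return set `N(x, U) = {n ≥ 0 : Tⁿ x ∈ U}`. -/
def returnSet (T : X →L[ℂ] X) (x : X) (U : Set X) : Set ℕ :=
  {n : ℕ | T^[n] x ∈ U}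

/-- `x` is uniformly recurrent for `T` if its return set to each of its neighbourhoods is
syndetic. -/
def IsUniformlyRecurrent (T : X →L[ℂ] X) (x : X) : Prop :=
  ∀ U ∈ 𝓝 x, IsSyndetic (returnSet T x U)

/-- The set of uniformly recurrent vectors of `T`. -/
def URec (T : X →L[ℂ] X) : Set X :=
  {x : X | IsUniformlyRecurrent T x}

/-- `T` is hypercyclic if some vector has a dense orbit `{Tⁿ x : n ≥ 0}`. -/
def IsHypercyclic (T : X →L[ℂ] X) : Prop :=
  ∃ x : X, Dense (Set.range fun n : ℕ => T^[n] x)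

end

end LinearDynamics

namespace LinearDynamics

open Filter

/-! ### Sequences defined by a condition on their initial segments -/

/-! The operator is `bidiagonal`: unimodular diagonal entries `f k` and small positive weights above
them, so each `f k` has a finitely supported eigenvector `eigenvec r f k`, and these span a dense
subspace. Every `f k` is `exp I` times a root of unity of order dividing some `2 * 3 ^ B`. On each
vector of the span a suitable iterate is therefore a unimodular scalar, which gives uniform
recurrence (`dense_uRec_bidiagonal`). Each eigenvector `u` is also a limit of eigenvectors `v` whose
eigenvalue is that of `u` times some `rot a`. For large `A`, `T ^ 3 ^ A` multiplies `u` by some `q`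
and `v` by `-q`. A small multiple of `v - u` is thus sent near a prescribed multiple of `u`, and
transitivity follows (`steersTo_eigenvec`). A periodic point would produce an eigenvector for a root
of unity. The weight at `n` is at most the distance from `f n` to the first `n + 1` roots of unity,
so its coordinates could not decay (`bidiagonal_eigenvector_eq_zero`). -/

/-- A sequence can be built term by term when the condition on its `k`-th term only involves the
terms before it and can always be met. -/
theorem exists_seq_of_initial_segments {α : Type*} [Nonempty α] (R : ℕ → (ℕ → α) → α → Prop)
    (hcongr : ∀ k f g z, (∀ j < k, f j = g j) → R k f z → R k g z)
    (hstep : ∀ k f, (∀ j < k, R j f (f j)) → ∃ z, R k f z) :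
    ∃ f : ℕ → α, ∀ k, R k f (f k) := by
  classical
  have hstep' : ∀ k f, ∃ z, (∀ j < k, R j f (f j)) → R k f z := by
    intro k f
    by_cases h : ∀ j < k, R j f (f j)
    · obtain ⟨z, hz⟩ := hstep k f h
      exact ⟨z, fun _ => hz⟩
    · exact ⟨Classical.arbitrary α, fun h' => absurd h' h⟩
  choose F hF using hstep'
  let g : ℕ → ℕ → α := fun n => Nat.rec (fun _ => Classical.arbitrary α)
    (fun k gk => Function.update gk k (F k gk)) n
  have hg : ∀ k, g (k + 1) = Function.update (g k) k (F k (g k)) := fun _ => rfl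
  have hstable : ∀ n j, j < n → g n j = g (j + 1) j := by
    intro n
    induction n with
    | zero => intro j hj; omega
    | succ n ih =>
      intro j hj
      rcases Nat.lt_succ_iff_lt_or_eq.1 hj with h | rfl
      · rw [hg n, Function.update_of_ne h.ne, ih j h]
      · rfl
  refine ⟨fun k => g (k + 1) k, fun k => ?_⟩
  induction k using Nat.strong_induction_on with
  | _ k ih =>
    have hk : g (k + 1) k = F k (g k) := by rw [hg, Function.update_self]
    refine hcongr k (g k) _ _ (fun j hj => hstable k j hj) ?_
    show R k (g k) (g (k + 1) k)
    rw [hk]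
    refine hF k (g k) fun j hj => ?_
    rw [hstable k j hj]
    exact hcongr j _ _ _ (fun i hi => (hstable k i (hi.trans hj)).symm) (ih j hj)

/-! ### General facts on linear dynamics -/

/-- Birkhoff's transitivity theorem. -/
theorem isHypercyclic_of_transitive {X : Type*} [NormedAddCommGroup X] [NormedSpace ℂ X]
    [CompleteSpace X] [TopologicalSpace.SeparableSpace X] (T : X →L[ℂ] X)
    (h : ∀ U V : Set X, IsOpen U → IsOpen V → U.Nonempty → V.Nonempty →
      ∃ n : ℕ, ∃ x ∈ U, T^[n] x ∈ V) : IsHypercyclic T := by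
  have : SecondCountableTopology X := UniformSpace.secondCountable_of_separable X
  let B := TopologicalSpace.countableBasis X
  let G : Set X → Set X := fun V => ⋃ n : ℕ, T^[n] ⁻¹' V
  have hopen : ∀ V ∈ B, IsOpen (G V) := fun V hV =>
    isOpen_iUnion fun n =>
      (TopologicalSpace.isOpen_of_mem_countableBasis hV).preimage (T.continuous.iterate n)
  have hdense : ∀ V ∈ B, Dense (G V) := by
    intro V hV
    refine dense_iff_inter_open.2 fun U hU hUne => ?_
    obtain ⟨n, x, hxU, hxV⟩ := h U V hU (TopologicalSpace.isOpen_of_mem_countableBasis hV) hUne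
      (TopologicalSpace.nonempty_of_mem_countableBasis hV)
    exact ⟨x, hxU, Set.mem_iUnion.2 ⟨n, hxV⟩⟩
  obtain ⟨x, hx⟩ :=
    (dense_biInter_of_isOpen hopen (TopologicalSpace.countable_countableBasis X) hdense).nonempty
  refine ⟨x, (TopologicalSpace.isBasis_countableBasis X).dense_iff.2 fun V hV _ => ?_⟩
  obtain ⟨n, hn⟩ := Set.mem_iUnion.1 (Set.mem_iInter₂.1 hx V hV)
  exact ⟨_, hn, n, rfl⟩

/-- The powers of a unimodular number return syndetically to any neighbourhood of `1`. -/
theorem isSyndetic_pow_near_one {ρ : ℂ} (hρ : ‖ρ‖ = 1) {δ : ℝ} (hδ : 0 < δ) :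
    IsSyndetic {l : ℕ | ‖ρ ^ l - 1‖ < δ} := by
  have htb : TotallyBounded (Set.range fun l : ℕ => ρ ^ l) := by
    refine (isCompact_closedBall (0 : ℂ) 1).totallyBounded.subset ?_
    rintro _ ⟨l, rfl⟩
    simp [hρ]
  obtain ⟨t, ht, htf, hcov⟩ := Metric.finite_approx_of_totallyBounded htb δ hδ
  obtain ⟨s, hs⟩ := htf.exists_finset_coe
  have hidx : ∀ y ∈ s, ∃ l : ℕ, ρ ^ l = y := fun y hy => ht (by rw [← hs]; exact hy)
  choose! idx hidx using hidx
  -- Some `ρ ^ idx y` is `δ`-close to `ρ ^ (m + s.sup idx)`; dividing by it gives a return time at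
  -- least `m`.
  refine ⟨s.sup idx, fun m => ?_⟩
  obtain ⟨y, hy, hd⟩ := Set.mem_iUnion₂.1 (hcov ⟨m + s.sup idx, rfl⟩)
  have hys : y ∈ s := by rw [← hs] at hy; exact hy
  have hle : idx y ≤ s.sup idx := Finset.le_sup hys
  refine ⟨m + s.sup idx - idx y, ?_, by omega, by omega⟩
  rw [Metric.mem_ball, dist_eq_norm, ← hidx y hys] at hd
  have heq : ρ ^ (m + s.sup idx) - ρ ^ idx y
      = ρ ^ idx y * (ρ ^ (m + s.sup idx - idx y) - 1) := by
    rw [mul_sub, ← pow_add, mul_one]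
    congr 2
    omega
  simp only [heq] at hd
  simpa [hρ] using hd

/-- A vector on which some iterate acts as a unimodular scalar is uniformly recurrent. -/
theorem isUniformlyRecurrent_of_pow_apply {X : Type*} [NormedAddCommGroup X] [NormedSpace ℂ X]
    (T : X →L[ℂ] X) {x : X} {M : ℕ} (hM : 0 < M) {ρ : ℂ} (hρ : ‖ρ‖ = 1)
    (hx : (T ^ M) x = ρ • x) : IsUniformlyRecurrent T x := by
  intro U hU
  obtain ⟨ε, hε, hball⟩ := Metric.mem_nhds_iff.1 hU
  have hpow : ∀ l : ℕ, T^[M * l] x = ρ ^ l • x := by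
    intro l
    induction l with
    | zero => simp
    | succ l ih =>
      rw [Nat.mul_succ, Nat.add_comm, Function.iterate_add_apply, ih,
        ← FunLike.coe_pow_eq_iterate, map_smul, hx, smul_smul, pow_succ]
  obtain ⟨N, hN⟩ := isSyndetic_pow_near_one hρ (δ := ε / (‖x‖ + 1)) (by positivity)
  refine ⟨M * (N + 1), fun m => ?_⟩
  obtain ⟨l, hl, h1, h2⟩ := hN (m / M + 1)
  refine ⟨M * l, hball ?_, ?_, ?_⟩
  · rw [Metric.mem_ball, dist_eq_norm, hpow]
    have : ρ ^ l • x - x = (ρ ^ l - 1) • x := by rw [sub_smul, one_smul]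
    rw [this, norm_smul]
    have hl' : ‖ρ ^ l - 1‖ < ε / (‖x‖ + 1) := hl
    rw [lt_div_iff₀ (by positivity)] at hl'
    nlinarith [norm_nonneg (ρ ^ l - 1)]
  · have := Nat.lt_mul_div_succ m hM
    exact this.le.trans (Nat.mul_le_mul_left M h1)
  · calc M * l ≤ M * (m / M + 1 + N) := Nat.mul_le_mul_left M h2
      _ = M * (m / M) + M * (N + 1) := by ring
      _ ≤ m + M * (N + 1) := by gcongr; exact Nat.mul_div_le m M

/-- If no root of unity is an eigenvalue, then the only periodic point is `0`. -/
theorem eq_zero_of_mem_periodicPts {X : Type*} [NormedAddCommGroup X] [NormedSpace ℂ X]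
    (T : X →L[ℂ] X)
    (h : ∀ (μ : ℂ) (p : ℕ), 0 < p → μ ^ p = 1 → ∀ x, T x = μ • x → x = 0)
    {x : X} (hx : x ∈ Function.periodicPts T) : x = 0 := by
  obtain ⟨p, hp, hper⟩ := hx
  -- `X ^ p - 1` splits, and each factor `T - a` is injective, so the factors can be stripped one by
  -- one.
  have key : ∀ s : Multiset ℂ, (∀ μ ∈ s, μ ^ p = 1) → ∀ y : X,
      (Polynomial.aeval (T : X →ₗ[ℂ] X)
        (s.map fun a => Polynomial.X - Polynomial.C a).prod) y = 0 → y = 0 := by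
    intro s
    induction s using Multiset.induction_on with
    | empty => intro _ y hy; simpa using hy
    | cons a s ih =>
      intro hs y hy
      refine ih (fun μ hμ => hs μ (Multiset.mem_cons_of_mem hμ)) y ?_
      refine h a p hp (hs a (Multiset.mem_cons_self a s)) _ ?_
      rw [Multiset.map_cons, Multiset.prod_cons, map_mul, Module.End.mul_apply] at hy
      simpa [sub_eq_zero] using hy
  have hmonic : (Polynomial.X ^ p - 1 : Polynomial ℂ).Monic :=
    Polynomial.monic_X_pow_sub_C 1 hp.ne'
  have hprod := (IsAlgClosed.splits (Polynomial.X ^ p - 1 : Polynomial ℂ)).eq_prod_roots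
  rw [hmonic.leadingCoeff, map_one, one_mul] at hprod
  refine key (Polynomial.X ^ p - 1 : Polynomial ℂ).roots (fun μ hμ => ?_) x ?_
  · have := (Polynomial.mem_roots hmonic.ne_zero).1 hμ
    simpa [sub_eq_zero] using this
  · rw [← hprod]
    have : T^[p] x = x := hper
    simp [Module.End.pow_apply, this]

/-! ### Weighted composition operators on `ℓ²` -/

/-- The Hilbert space `ℓ²(ℕ)`. -/
abbrev Ell2 : Type := lp (fun _ : ℕ => ℂ) 2

theorem summable_sq_weightedComp {c : ℕ → ℂ} (hc : ∀ n, ‖c n‖ ≤ 1) {σ : ℕ → ℕ}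
    (hσ : Function.Injective σ) (x : Ell2) :
    Summable (fun n => ‖c n * x (σ n)‖ ^ 2) ∧
      ∑' n, ‖c n * x (σ n)‖ ^ 2 ≤ ‖x‖ ^ 2 := by
  have hx : Summable fun n => ‖x n‖ ^ 2 := by
    simpa using (lp.memℓp x).summable (by norm_num)
  have hxn : ‖x‖ ^ 2 = ∑' n, ‖x n‖ ^ 2 := by
    simpa using lp.norm_rpow_eq_tsum (p := 2) (by norm_num) x
  have hσs : Summable fun n => ‖x (σ n)‖ ^ 2 := hx.comp_injective hσ
  have hle : ∀ n, ‖c n * x (σ n)‖ ^ 2 ≤ ‖x (σ n)‖ ^ 2 := by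
    intro n
    rw [norm_mul]
    gcongr
    exact mul_le_of_le_one_left (norm_nonneg _) (hc n)
  have hs := Summable.of_nonneg_of_le (fun n => by positivity) hle hσs
  refine ⟨hs, (hs.tsum_le_tsum hle hσs).trans ?_⟩
  rw [hxn]
  exact hσs.tsum_le_tsum_of_inj σ hσ (fun n _ => by positivity) (fun n => le_rfl) hx

/-- The operator `x ↦ (c n * x (σ n))ₙ` on `ℓ²(ℕ)`. -/
noncomputable def weightedComp (c : ℕ → ℂ) (hc : ∀ n, ‖c n‖ ≤ 1) (σ : ℕ → ℕ)
    (hσ : Function.Injective σ) : Ell2 →L[ℂ] Ell2 :=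
  LinearMap.mkContinuous
    { toFun := fun x => ⟨fun n => c n * x (σ n), memℓp_gen (by
        simpa using (summable_sq_weightedComp hc hσ x).1)⟩
      map_add' := fun x y => by ext n; exact mul_add _ _ _
      map_smul' := fun a x => by ext n; simp [mul_left_comm] }
    1 (fun x => by
      rw [one_mul]
      refine le_of_sq_le_sq ?_ (norm_nonneg _)
      refine le_trans (le_of_eq ?_) (summable_sq_weightedComp hc hσ x).2
      simpa using lp.norm_rpow_eq_tsum (p := 2) (by norm_num)
        (⟨fun n => c n * x (σ n), memℓp_gen (by
          simpa using (summable_sq_weightedComp hc hσ x).1)⟩ : Ell2))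

theorem weightedComp_apply (c : ℕ → ℂ) (hc : ∀ n, ‖c n‖ ≤ 1) (σ : ℕ → ℕ)
    (hσ : Function.Injective σ) (x : Ell2) (n : ℕ) :
    weightedComp c hc σ hσ x n = c n * x (σ n) := rfl

/-! ### Angles and weights -/

/-- The primitive `2 * 3 ^ a`-th root of unity `exp (iπ / 3 ^ a)`. -/
noncomputable def rot (a : ℕ) : ℂ := Complex.exp (((Real.pi / 3 ^ a : ℝ) : ℂ) * Complex.I)

theorem norm_rot (a : ℕ) : ‖rot a‖ = 1 := Complex.norm_exp_ofReal_mul_I _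

/-- `3 ^ (A - a)` is odd, so one exponent gives `-1` for all `a ≤ A` at once. -/
theorem rot_pow {a A : ℕ} (h : a ≤ A) : rot a ^ 3 ^ A = -1 := by
  obtain ⟨b, rfl⟩ := Nat.exists_eq_add_of_le h
  have h0 : rot a ^ 3 ^ a = -1 := by
    rw [rot, ← Complex.exp_nat_mul, ← Complex.exp_pi_mul_I]
    congr 1
    push_cast
    field_simp
  rw [pow_add, pow_mul, h0]
  exact Odd.neg_one_pow (Odd.pow (by decide))

theorem rot_ne_one (a : ℕ) : rot a ≠ 1 := by
  intro h
  have := rot_pow (le_refl a)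
  rw [h, one_pow] at this
  norm_num at this

theorem tendsto_rot : Tendsto rot atTop (𝓝 1) := by
  have h1 : Tendsto (fun a : ℕ => Real.pi / 3 ^ a) atTop (𝓝 0) :=
    tendsto_const_nhds.div_atTop (tendsto_pow_atTop_atTop_of_one_lt (by norm_num))
  have h2 : Continuous fun t : ℝ => Complex.exp ((t : ℂ) * Complex.I) := by fun_prop
  have h3 := (h2.tendsto 0).comp h1
  rw [Complex.ofReal_zero, zero_mul, Complex.exp_zero] at h3
  exact h3

/-- Irrationality of `π`; it keeps all the eigenvalues away from the roots of unity. -/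
theorem exp_I_pow_ne_one {p : ℕ} (hp : 0 < p) : Complex.exp Complex.I ^ p ≠ 1 := by
  intro h
  rw [← Complex.exp_nat_mul, Complex.exp_eq_one_iff] at h
  obtain ⟨n, hn⟩ := h
  have h1 : (p : ℂ) = n * (2 * Real.pi) := by
    apply mul_right_cancel₀ Complex.I_ne_zero
    rw [hn]; ring
  have h2 : (p : ℝ) = n * (2 * Real.pi) := by exact_mod_cast h1
  have hn0 : (n : ℝ) ≠ 0 := by
    intro h0
    rw [h0, zero_mul] at h2
    exact hp.ne' (by exact_mod_cast h2)
  refine irrational_pi ⟨p / (2 * n), ?_⟩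
  push_cast
  rw [h2]
  field_simp

/-- The roots of unity can be enumerated. -/
theorem exists_enum_rootsOfUnity : ∃ r : ℕ → ℂ,
    {μ : ℂ | ∃ p : ℕ, 0 < p ∧ μ ^ p = 1} = Set.range r := by
  refine Set.Countable.exists_eq_range ?_ ⟨1, 1, one_pos, one_pow 1⟩
  have : {μ : ℂ | ∃ p : ℕ, 0 < p ∧ μ ^ p = 1}
      ⊆ ⋃ p : ℕ, (Polynomial.nthRootsFinset (p + 1) (1 : ℂ) : Set ℂ) := by
    rintro μ ⟨p, hp, h⟩
    refine Set.mem_iUnion.2 ⟨p - 1, ?_⟩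
    rw [Nat.sub_add_cancel hp]
    exact (Polynomial.mem_nthRootsFinset hp (1 : ℂ)).2 h
  exact (Set.countable_iUnion fun p => (Finset.finite_toSet _).countable).mono this

/-- The distance, cut off at `1`, from `z` to the first `j + 1` terms of `r`. -/
noncomputable def cutoffDist (r : ℕ → ℂ) (j : ℕ) (z : ℂ) : ℝ :=
  min 1 ((Finset.range (j + 1)).inf' Finset.nonempty_range_add_one fun i => ‖r i - z‖)

theorem cutoffDist_le_one (r : ℕ → ℂ) (j : ℕ) (z : ℂ) : cutoffDist r j z ≤ 1 := min_le_left _ _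

theorem cutoffDist_le (r : ℕ → ℂ) {i j : ℕ} (h : i ≤ j) (z : ℂ) :
    cutoffDist r j z ≤ ‖r i - z‖ :=
  (min_le_right _ _).trans (Finset.inf'_le _ (Finset.mem_range.2 (Nat.lt_succ_of_le h)))

theorem cutoffDist_pos {r : ℕ → ℂ} {z : ℂ} (h : z ∉ Set.range r) (j : ℕ) :
    0 < cutoffDist r j z := by
  refine lt_min one_pos ((Finset.lt_inf'_iff _).2 fun i _ => norm_pos_iff.2 ?_)
  exact sub_ne_zero.2 fun hi => h ⟨i, hi⟩

/-- The coordinates of the formal eigenvector, normalised by its first coordinate, for the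
eigenvalue `μ` of the upper bidiagonal matrix with diagonal `f` and weights
`cutoffDist r j (f j)`. -/
noncomputable def eigenCoeff (r f : ℕ → ℂ) (μ : ℂ) (n : ℕ) : ℂ :=
  ∏ j ∈ Finset.range n, (μ - f j) / (cutoffDist r j (f j) : ℂ)

theorem eigenCoeff_congr (r : ℕ → ℂ) {f g : ℕ → ℂ} {n : ℕ} (h : ∀ j < n, f j = g j) (μ : ℂ) :
    eigenCoeff r f μ n = eigenCoeff r g μ n :=
  Finset.prod_congr rfl fun j hj => by rw [h j (Finset.mem_range.1 hj)]

theorem continuous_eigenCoeff (r f : ℕ → ℂ) (n : ℕ) :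
    Continuous fun μ => eigenCoeff r f μ n := by
  unfold eigenCoeff
  fun_prop

/-- The factor `j = k` vanishes, so the formal eigenvector for `f k` is finitely supported. -/
theorem eigenCoeff_eq_zero (r f : ℕ → ℂ) {k n : ℕ} (h : k < n) : eigenCoeff r f (f k) n = 0 :=
  Finset.prod_eq_zero (Finset.mem_range.2 h) (by simp)

/-- The index of the earlier eigenvalue that the `k`-th one approximates. -/
def parent (k : ℕ) : ℕ := (Nat.unpair (k - 1)).1

theorem parent_lt {k : ℕ} (hk : k ≠ 0) : parent k < k := by
  have := Nat.unpair_left_le (k - 1)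
  unfold parent
  omega

theorem exists_parent_eq (i m : ℕ) : ∃ k, m < k ∧ parent k = i :=
  ⟨Nat.pair i m + 1, Nat.lt_succ_of_le (Nat.right_le_pair i m), by simp [parent]⟩

/-- The condition on the `k`-th eigenvalue `z`, given the eigenvalues `f j` with `j < k`. -/
def IsNextEigenvalue (r : ℕ → ℂ) (k : ℕ) (f : ℕ → ℂ) (z : ℂ) : Prop :=
  ‖z‖ = 1 ∧ (k = 0 → z = Complex.exp Complex.I) ∧
    (k ≠ 0 → (∃ a, z = f (parent k) * rot a) ∧ (∀ j < k, z ≠ f j) ∧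
      ∑ n ∈ Finset.range (k + 1), ‖eigenCoeff r f z n - eigenCoeff r f (f (parent k)) n‖
        < 1 / ((k : ℝ) + 1))

/-- The candidates `f (parent k) * rot a` tend to `f (parent k)`, and coefficients of index at most
`k` are continuous in `μ` and involve only earlier eigenvalues. -/
theorem exists_eigenvalues (r : ℕ → ℂ) : ∃ f : ℕ → ℂ, ∀ k, IsNextEigenvalue r k f (f k) := by
  refine exists_seq_of_initial_segments _ ?_ ?_
  · rintro k f g z h ⟨h1, h2, h3⟩
    refine ⟨h1, h2, fun hk => ?_⟩
    obtain ⟨ha, hne, hsum⟩ := h3 hk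
    rw [h _ (parent_lt hk)] at ha hsum
    refine ⟨ha, fun j hj => h j hj ▸ hne j hj, ?_⟩
    refine lt_of_eq_of_lt (Finset.sum_congr rfl fun n hn => ?_) hsum
    have hn' : ∀ j < n, f j = g j := fun j hj => h j (by have := Finset.mem_range.1 hn; omega)
    rw [eigenCoeff_congr r hn', eigenCoeff_congr r hn']
  · intro k f hf
    rcases eq_or_ne k 0 with rfl | hk
    · exact ⟨Complex.exp Complex.I, by simpa using Complex.norm_exp_ofReal_mul_I 1,
        fun _ => rfl, fun h => absurd rfl h⟩
    have hnorm : ‖f (parent k)‖ = 1 := (hf _ (parent_lt hk)).1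
    have hne0 : f (parent k) ≠ 0 := by
      intro h
      rw [h, norm_zero] at hnorm
      exact zero_ne_one hnorm
    have hlim : Tendsto (fun a => f (parent k) * rot a) atTop (𝓝 (f (parent k))) := by
      simpa using tendsto_rot.const_mul (f (parent k))
    have hdist : ∀ᶠ a in atTop, ∀ j ∈ Set.Iio k, f (parent k) * rot a ≠ f j := by
      refine (eventually_all_finite (Set.finite_Iio k)).2 fun j _ => ?_
      by_cases h : f (parent k) = f j
      · refine Eventually.of_forall fun a ha => rot_ne_one a ?_
        rw [← h] at ha
        exact mul_left_cancel₀ hne0 (ha.trans (mul_one _).symm)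
      · exact hlim.eventually_ne h
    have hclose : ∀ᶠ a in atTop, ∑ n ∈ Finset.range (k + 1),
        ‖eigenCoeff r f (f (parent k) * rot a) n - eigenCoeff r f (f (parent k)) n‖
          < 1 / ((k : ℝ) + 1) := by
      have hc : Continuous fun μ => ∑ n ∈ Finset.range (k + 1),
          ‖eigenCoeff r f μ n - eigenCoeff r f (f (parent k)) n‖ :=
        continuous_finsetSum _ fun n _ =>
          ((continuous_eigenCoeff r f n).sub continuous_const).norm
      refine ((hc.tendsto _).comp hlim).eventually (gt_mem_nhds ?_)
      simp only [sub_self, norm_zero, Finset.sum_const_zero]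
      positivity
    obtain ⟨a, ha1, ha2⟩ := (hdist.and hclose).exists
    exact ⟨f (parent k) * rot a, by rw [norm_mul, hnorm, norm_rot, one_mul],
      fun h => absurd h hk, fun _ => ⟨⟨a, rfl⟩, ha1, ha2⟩⟩

/-! ### The bidiagonal operator: point spectrum, recurrence and hypercyclicity -/

section Construction

variable {r f : ℕ → ℂ}

/-- Following parents back to `0` expresses `f k` as `exp I` times finitely many `rot a`, all killed
once `B` exceeds every such `a`. -/
theorem eventually_pow_eq (hf : ∀ k, IsNextEigenvalue r k f (f k)) (k : ℕ) :
    ∀ᶠ B in atTop, f k ^ (2 * 3 ^ B) = Complex.exp Complex.I ^ (2 * 3 ^ B) := by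
  induction k using Nat.strong_induction_on with
  | _ k ih =>
    rcases eq_or_ne k 0 with rfl | hk
    · exact Eventually.of_forall fun B => by rw [(hf 0).2.1 rfl]
    · obtain ⟨⟨a, ha⟩, -, -⟩ := (hf k).2.2 hk
      filter_upwards [ih _ (parent_lt hk), eventually_ge_atTop a] with B hB haB
      have h1 : rot a ^ (2 * 3 ^ B) = 1 := by
        rw [mul_comm, pow_mul, rot_pow haB]
        norm_num
      rw [ha, mul_pow, h1, mul_one, hB]

theorem eigenvalue_pow_ne_one (hf : ∀ k, IsNextEigenvalue r k f (f k)) (k : ℕ) {p : ℕ}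
    (hp : 0 < p) : f k ^ p ≠ 1 := by
  intro h
  obtain ⟨B, hB⟩ := (eventually_pow_eq hf k).exists
  refine exp_I_pow_ne_one (p := 2 * 3 ^ B * p) (by positivity) ?_
  rw [pow_mul, ← hB, ← pow_mul, mul_comm, pow_mul, h, one_pow]

theorem cutoffDist_eigenvalue_pos (hr : {μ : ℂ | ∃ p : ℕ, 0 < p ∧ μ ^ p = 1} = Set.range r)
    (hf : ∀ k, IsNextEigenvalue r k f (f k)) (j : ℕ) : 0 < cutoffDist r j (f j) := by
  refine cutoffDist_pos ?_ j
  rw [← hr]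
  rintro ⟨p, hp, h⟩
  exact eigenvalue_pow_ne_one hf j hp h

/-- The upper bidiagonal operator with eigenvalues `f k` and weights `cutoffDist r k (f k)`. -/
noncomputable def bidiagonal (hr : {μ : ℂ | ∃ p : ℕ, 0 < p ∧ μ ^ p = 1} = Set.range r)
    (hf : ∀ k, IsNextEigenvalue r k f (f k)) : Ell2 →L[ℂ] Ell2 :=
  weightedComp f (fun n => (hf n).1.le) id Function.injective_id +
    weightedComp (fun n => (cutoffDist r n (f n) : ℂ))
      (fun n => by
        rw [Complex.norm_real, Real.norm_of_nonneg (cutoffDist_eigenvalue_pos hr hf n).le]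
        exact cutoffDist_le_one _ _ _) Nat.succ Nat.succ_injective

theorem bidiagonal_apply (hr : {μ : ℂ | ∃ p : ℕ, 0 < p ∧ μ ^ p = 1} = Set.range r)
    (hf : ∀ k, IsNextEigenvalue r k f (f k)) (x : Ell2) (n : ℕ) :
    bidiagonal hr hf x n = f n * x n + (cutoffDist r n (f n) : ℂ) * x (n + 1) := rfl

/-- No root of unity is an eigenvalue: the coordinates of an eigenvector would eventually
increase in modulus. -/
theorem bidiagonal_eigenvector_eq_zero
    (hr : {μ : ℂ | ∃ p : ℕ, 0 < p ∧ μ ^ p = 1} = Set.range r)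
    (hf : ∀ k, IsNextEigenvalue r k f (f k)) {μ : ℂ} {p : ℕ} (hp : 0 < p) (hμ : μ ^ p = 1)
    {x : Ell2} (hx : bidiagonal hr hf x = μ • x) : x = 0 := by
  obtain ⟨i, hi⟩ : μ ∈ Set.range r := hr ▸ ⟨p, hp, hμ⟩
  have hrec : ∀ n, (cutoffDist r n (f n) : ℂ) * x (n + 1) = (μ - f n) * x n := by
    intro n
    have h := congrArg (fun y : Ell2 => y n) hx
    simp only [bidiagonal_apply, lp.coeFn_smul, Pi.smul_apply, smul_eq_mul] at h
    linear_combination h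
  have hne : ∀ n, μ - f n ≠ 0 := fun n h =>
    eigenvalue_pow_ne_one hf n hp (by rw [← sub_eq_zero.1 h, hμ])
  have hgrow : ∀ n, i ≤ n → ‖x n‖ ≤ ‖x (n + 1)‖ := by
    intro n hn
    have hpos := cutoffDist_eigenvalue_pos hr hf n
    have h := congrArg norm (hrec n)
    rw [norm_mul, norm_mul, Complex.norm_real, Real.norm_of_nonneg hpos.le] at h
    -- From index `i` on, `μ = r i` is among the points whose distance to `f n` bounds the weight.
    have hle : cutoffDist r n (f n) ≤ ‖μ - f n‖ := hi ▸ cutoffDist_le r hn (f n)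
    refine le_of_mul_le_mul_left ?_ hpos
    rw [h]
    exact mul_le_mul_of_nonneg_right hle (norm_nonneg _)
  have hmono : ∀ n m, i ≤ n → ‖x n‖ ≤ ‖x (n + m)‖ := by
    intro n m hn
    induction m with
    | zero => rfl
    | succ m ih => exact ih.trans (hgrow _ (by omega))
  have hlim : Tendsto (fun n => ‖x n‖) atTop (𝓝 0) := by
    have hs : Summable fun n => ‖x n‖ ^ 2 := by
      simpa using (lp.memℓp x).summable (by norm_num)
    simpa [Function.comp_def, Real.sqrt_sq] using (Real.continuous_sqrt.tendsto 0).comp hs.tendsto_atTop_zero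
  have hlarge : ∀ n, i ≤ n → x n = 0 := by
    intro n hn
    refine norm_le_zero_iff.1 (ge_of_tendsto hlim ?_)
    filter_upwards [eventually_ge_atTop n] with m hm
    have := hmono n (m - n) hn
    rwa [Nat.add_sub_cancel' hm] at this
  have hback : ∀ n, x (n + 1) = 0 → x n = 0 := by
    intro n h
    have := hrec n
    rw [h, mul_zero] at this
    exact (mul_eq_zero.1 this.symm).resolve_left (hne n)
  have hall : ∀ m n, x (n + m) = 0 → x n = 0 := by
    intro m
    induction m with
    | zero => exact fun n h => h
    | succ m ih => exact fun n h => ih n (hback _ h)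
  ext n
  exact hall i n (hlarge _ (by omega))

/-- The eigenvector of the bidiagonal operator for the eigenvalue `f k`. -/
noncomputable def eigenvec (r f : ℕ → ℂ) (k : ℕ) : Ell2 :=
  ∑ n ∈ Finset.range (k + 1), lp.single 2 n (eigenCoeff r f (f k) n)

/-- Padding with zeros lets an eigenvector and its parent be compared over one index range. -/
theorem sum_single_eigenCoeff (r f : ℕ → ℂ) {i k : ℕ} (h : i ≤ k) :
    ∑ n ∈ Finset.range (k + 1), lp.single 2 n (eigenCoeff r f (f i) n) = eigenvec r f i := by
  refine (Finset.sum_subset (Finset.range_mono (by omega)) fun n _ hn => ?_).symm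
  rw [eigenCoeff_eq_zero r f (by simpa using hn)]
  exact lp.single_zero 2 n

theorem eigenvec_apply (r f : ℕ → ℂ) (k n : ℕ) :
    eigenvec r f k n = eigenCoeff r f (f k) n := by
  rw [eigenvec, lp.coeFn_sum, Finset.sum_apply]
  simp only [lp.single_apply, Pi.single_apply]
  rw [Finset.sum_ite_eq]
  split_ifs with h
  · rfl
  · rw [eigenCoeff_eq_zero r f (by simpa using h)]

theorem norm_eigenvec_sub_lt (hf : ∀ k, IsNextEigenvalue r k f (f k)) {k : ℕ} (hk : k ≠ 0) :
    ‖eigenvec r f k - eigenvec r f (parent k)‖ < 1 / ((k : ℝ) + 1) := by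
  rw [← sum_single_eigenCoeff r f (parent_lt hk).le, eigenvec, ← Finset.sum_sub_distrib]
  refine ((norm_sum_le _ _).trans_eq (Finset.sum_congr rfl fun n _ => ?_)).trans_lt
    ((hf k).2.2 hk).2.2
  rw [← lp.single_sub, lp.norm_single (by norm_num)]

theorem bidiagonal_eigenvec (hr : {μ : ℂ | ∃ p : ℕ, 0 < p ∧ μ ^ p = 1} = Set.range r)
    (hf : ∀ k, IsNextEigenvalue r k f (f k)) (k : ℕ) :
    bidiagonal hr hf (eigenvec r f k) = f k • eigenvec r f k := by
  ext n
  have hpos : (cutoffDist r n (f n) : ℂ) ≠ 0 :=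
    Complex.ofReal_ne_zero.2 (cutoffDist_eigenvalue_pos hr hf n).ne'
  rw [bidiagonal_apply, lp.coeFn_smul, Pi.smul_apply, smul_eq_mul, eigenvec_apply,
    eigenvec_apply]
  have : eigenCoeff r f (f k) (n + 1)
      = eigenCoeff r f (f k) n * ((f k - f n) / (cutoffDist r n (f n) : ℂ)) :=
    Finset.prod_range_succ _ _
  rw [this]
  field_simp
  ring

theorem bidiagonal_pow_eigenvec (hr : {μ : ℂ | ∃ p : ℕ, 0 < p ∧ μ ^ p = 1} = Set.range r)
    (hf : ∀ k, IsNextEigenvalue r k f (f k)) (k N : ℕ) :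
    (bidiagonal hr hf ^ N) (eigenvec r f k) = f k ^ N • eigenvec r f k := by
  induction N with
  | zero => simp
  | succ N ih =>
    rw [pow_succ, mul_apply_eq_comp, bidiagonal_eigenvec, map_smul, ih, smul_smul,
      pow_succ']

/-- The system is triangular: `f k` differs from all earlier eigenvalues, so the `k`-th coordinate
of `eigenvec r f k` is non-zero. -/
theorem dense_span_eigenvec (hr : {μ : ℂ | ∃ p : ℕ, 0 < p ∧ μ ^ p = 1} = Set.range r)
    (hf : ∀ k, IsNextEigenvalue r k f (f k)) :
    Dense (Submodule.span ℂ (Set.range (eigenvec r f)) : Set Ell2) := by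
  have hne : ∀ k, eigenCoeff r f (f k) k ≠ 0 := by
    intro k
    refine Finset.prod_ne_zero_iff.2 fun j hj => div_ne_zero (sub_ne_zero.2 ?_)
      (Complex.ofReal_ne_zero.2 (cutoffDist_eigenvalue_pos hr hf j).ne')
    have hj' := Finset.mem_range.1 hj
    exact ((hf k).2.2 (by omega)).2.1 j hj'
  have hsingle : ∀ (k : ℕ) (c : ℂ),
      (lp.single 2 k c : Ell2) ∈ Submodule.span ℂ (Set.range (eigenvec r f)) := by
    intro k
    induction k using Nat.strong_induction_on with
    | _ k ih =>
      intro c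
      have h1 : eigenvec r f k ∈ Submodule.span ℂ (Set.range (eigenvec r f)) :=
        Submodule.subset_span ⟨k, rfl⟩
      have h2 := Submodule.sum_mem (Submodule.span ℂ (Set.range (eigenvec r f)))
        (t := Finset.range k) (f := fun n => (lp.single 2 n (eigenCoeff r f (f k) n) : Ell2))
        fun n hn => ih n (Finset.mem_range.1 hn) _
      have h3 := Submodule.smul_mem _ (c / eigenCoeff r f (f k) k) (Submodule.sub_mem _ h1 h2)
      rwa [eigenvec, Finset.sum_range_succ, add_sub_cancel_left, ← lp.single_smul, smul_eq_mul,
        div_mul_cancel₀ _ (hne k)] at h3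
  intro x
  refine mem_closure_of_tendsto (lp.hasSum_single (by norm_num) x) (Eventually.of_forall ?_)
  exact fun s => Submodule.sum_mem _ fun n _ => hsingle n _

theorem dense_uRec_bidiagonal (hr : {μ : ℂ | ∃ p : ℕ, 0 < p ∧ μ ^ p = 1} = Set.range r)
    (hf : ∀ k, IsNextEigenvalue r k f (f k)) : Dense (URec (bidiagonal hr hf)) := by
  refine (dense_span_eigenvec hr hf).mono fun x hx => ?_
  have key : ∀ᶠ B in atTop, (bidiagonal hr hf ^ (2 * 3 ^ B)) x
      = Complex.exp Complex.I ^ (2 * 3 ^ B) • x := by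
    induction hx using Submodule.span_induction with
    | mem x hx =>
      obtain ⟨k, rfl⟩ := hx
      filter_upwards [eventually_pow_eq hf k] with B hB
      rw [bidiagonal_pow_eigenvec, hB]
    | zero => simp
    | add x y _ _ hx hy =>
      filter_upwards [hx, hy] with B h1 h2
      rw [map_add, h1, h2, smul_add]
    | smul c x _ hx =>
      filter_upwards [hx] with B h1
      rw [map_smul, h1, smul_comm]
  obtain ⟨B, hB⟩ := key.exists
  refine isUniformlyRecurrent_of_pow_apply _ (M := 2 * 3 ^ B) (by positivity) ?_ hB
  rw [norm_pow, ← (hf 0).2.1 rfl, (hf 0).1, one_pow]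

/-- Along the iterates of order `3 ^ A`, arbitrarily small perturbations of `x` are sent
arbitrarily close to `y`. -/
def SteersTo (T : Ell2 →L[ℂ] Ell2) (x y : Ell2) : Prop :=
  ∀ ε > 0, ∀ᶠ A : ℕ in atTop, ∃ z, ‖z‖ < ε ∧ ‖(T ^ 3 ^ A) (x + z) - y‖ < ε

/-- Requiring all large `A`, not just some, provides a common iterate for both pairs. -/
theorem SteersTo.add {T : Ell2 →L[ℂ] Ell2} {x y x' y' : Ell2} (h : SteersTo T x y)
    (h' : SteersTo T x' y') : SteersTo T (x + x') (y + y') := by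
  intro ε hε
  filter_upwards [h (ε / 2) (half_pos hε), h' (ε / 2) (half_pos hε)] with A hA hA'
  obtain ⟨z, hz, hzy⟩ := hA
  obtain ⟨z', hz', hzy'⟩ := hA'
  refine ⟨z + z', (norm_add_le _ _).trans_lt (by linarith), ?_⟩
  have : (T ^ 3 ^ A) (x + x' + (z + z')) - (y + y')
      = ((T ^ 3 ^ A) (x + z) - y) + ((T ^ 3 ^ A) (x' + z') - y') := by
    simp only [map_add]; abel
  rw [this]
  exact (norm_add_le _ _).trans_lt (by linarith)

theorem SteersTo.smul {T : Ell2 →L[ℂ] Ell2} {x y : Ell2} (c : ℂ) (h : SteersTo T x y) :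
    SteersTo T (c • x) (c • y) := by
  intro ε hε
  filter_upwards [h (ε / (‖c‖ + 1)) (by positivity)] with A hA
  obtain ⟨z, hz, hzy⟩ := hA
  have hscale : ∀ v : Ell2, ‖v‖ < ε / (‖c‖ + 1) → ‖c • v‖ < ε := by
    intro v hv
    rw [lt_div_iff₀ (by positivity)] at hv
    rw [norm_smul]
    nlinarith [norm_nonneg v]
  refine ⟨c • z, hscale z hz, ?_⟩
  rw [← smul_add, map_smul, ← smul_sub]
  exact hscale _ hzy

theorem SteersTo.zero (T : Ell2 →L[ℂ] Ell2) : SteersTo T 0 0 := fun ε hε =>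
  Eventually.of_forall fun A => ⟨0, by simpa using hε, by simpa using hε⟩

/-- Adding a small multiple of `eigenvec k - eigenvec i`, where `eigenvec k` approximates
`eigenvec i`, steers any multiple of `eigenvec i` to any other one. -/
theorem steersTo_eigenvec (hr : {μ : ℂ | ∃ p : ℕ, 0 < p ∧ μ ^ p = 1} = Set.range r)
    (hf : ∀ k, IsNextEigenvalue r k f (f k)) (i : ℕ) (a b : ℂ) :
    SteersTo (bidiagonal hr hf) (a • eigenvec r f i) (b • eigenvec r f i) := by
  intro ε hε
  obtain ⟨m, hm⟩ := exists_nat_one_div_lt (K := ℝ) (ε := ε / (‖a‖ + ‖b‖ + 1)) (by positivity)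
  obtain ⟨k, hmk, rfl⟩ := exists_parent_eq i m
  have hk : k ≠ 0 := by omega
  obtain ⟨⟨e, he⟩, -, -⟩ := (hf k).2.2 hk
  set d := eigenvec r f k - eigenvec r f (parent k) with hd
  have hdn : ‖d‖ < ε / (‖a‖ + ‖b‖ + 1) := by
    refine ((norm_eigenvec_sub_lt hf hk).trans_le ?_).trans hm
    gcongr
  have hscale : ∀ c : ℂ, ‖c‖ ≤ (‖a‖ + ‖b‖) / 2 → ‖c • d‖ < ε := by
    intro c hc
    rw [lt_div_iff₀ (by positivity)] at hdn
    rw [norm_smul]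
    nlinarith [norm_nonneg d, norm_nonneg a, norm_nonneg b]
  filter_upwards [eventually_ge_atTop e] with A hA
  set q := f (parent k) ^ 3 ^ A with hq
  have hqn : ‖q‖ = 1 := by rw [hq, norm_pow, (hf _).1, one_pow]
  have hq0 : q ≠ 0 := by
    intro h
    rw [h, norm_zero] at hqn
    exact zero_ne_one hqn
  have hfk : f k ^ 3 ^ A = -q := by rw [he, mul_pow, rot_pow hA, mul_neg_one]
  have hc : ‖(a - b / q) / 2‖ ≤ (‖a‖ + ‖b‖) / 2 := by
    rw [norm_div, Complex.norm_ofNat]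
    gcongr
    refine (norm_sub_le _ _).trans_eq ?_
    rw [norm_div, hqn, div_one]
  -- With `c = (a - b / q) / 2`, the image is `(a * q - 2 * c * q) • eigenvec r f (parent k) - (c *
  -- q) • d`, whose first coefficient is `b`.
  refine ⟨((a - b / q) / 2) • d, hscale _ hc, ?_⟩
  have : (bidiagonal hr hf ^ 3 ^ A) (a • eigenvec r f (parent k) + ((a - b / q) / 2) • d)
      - b • eigenvec r f (parent k) = (-q * ((a - b / q) / 2)) • d := by
    rw [hd, map_add, map_smul, map_smul, map_sub, bidiagonal_pow_eigenvec,
      bidiagonal_pow_eigenvec, hfk, ← hq]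
    match_scalars <;> field_simp <;> ring
  rw [this]
  refine hscale _ ?_
  rw [norm_mul, norm_neg, hqn, one_mul]
  exact hc

theorem isHypercyclic_bidiagonal (hr : {μ : ℂ | ∃ p : ℕ, 0 < p ∧ μ ^ p = 1} = Set.range r)
    (hf : ∀ k, IsNextEigenvalue r k f (f k)) : IsHypercyclic (bidiagonal hr hf) := by
  have hdense := dense_span_eigenvec hr hf
  have hsep : TopologicalSpace.SeparableSpace Ell2 := by
    have h : TopologicalSpace.IsSeparable
        (Submodule.span ℂ (Set.range (eigenvec r f)) : Set Ell2) :=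
      (Set.countable_range (eigenvec r f)).isSeparable.span
    replace h := h.closure
    rw [hdense.closure_eq] at h
    exact TopologicalSpace.isSeparable_univ_iff.1 h
  have hfrom : ∀ x ∈ Submodule.span ℂ (Set.range (eigenvec r f)),
      SteersTo (bidiagonal hr hf) x 0 := by
    intro x hx
    induction hx using Submodule.span_induction with
    | mem x hx =>
      obtain ⟨i, rfl⟩ := hx
      simpa using steersTo_eigenvec hr hf i 1 0
    | zero => exact SteersTo.zero _
    | add x y _ _ hx hy => simpa using hx.add hy
    | smul c x _ hx => simpa using hx.smul c
  have hto : ∀ y ∈ Submodule.span ℂ (Set.range (eigenvec r f)),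
      SteersTo (bidiagonal hr hf) 0 y := by
    intro y hy
    induction hy using Submodule.span_induction with
    | mem y hy =>
      obtain ⟨i, rfl⟩ := hy
      simpa using steersTo_eigenvec hr hf i 0 1
    | zero => exact SteersTo.zero _
    | add x y _ _ hx hy => simpa using hx.add hy
    | smul c x _ hx => simpa using hx.smul c
  refine isHypercyclic_of_transitive _ fun U V hU hV hUne hVne => ?_
  obtain ⟨x, hxU, hx⟩ := hdense.inter_open_nonempty U hU hUne
  obtain ⟨y, hyV, hy⟩ := hdense.inter_open_nonempty V hV hVne
  obtain ⟨ε, hε, hεU⟩ := Metric.isOpen_iff.1 hU x hxU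
  obtain ⟨δ, hδ, hδV⟩ := Metric.isOpen_iff.1 hV y hyV
  have hxy : SteersTo (bidiagonal hr hf) x y := by simpa using (hfrom x hx).add (hto y hy)
  obtain ⟨A, z, hz, hzy⟩ := (hxy (min ε δ) (lt_min hε hδ)).exists
  refine ⟨3 ^ A, x + z, hεU ?_, hδV ?_⟩
  · rw [Metric.mem_ball, dist_eq_norm, add_sub_cancel_left]
    exact hz.trans_le (min_le_left _ _)
  · rw [← FunLike.coe_pow_eq_iterate, Metric.mem_ball, dist_eq_norm]
    exact hzy.trans_le (min_le_right _ _)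

end Construction

end LinearDynamics

/-- The Hilbert space is the complex sequence space `ℓ²(ℕ)`. -/
theorem corollary4p6 :
    ∃ T : lp (fun _ : ℕ => ℂ) 2 →L[ℂ] lp (fun _ : ℕ => ℂ) 2,
      LinearDynamics.IsHypercyclic T ∧
      Dense (LinearDynamics.URec T) ∧
      ∀ x : lp (fun _ : ℕ => ℂ) 2, x ∈ Function.periodicPts T → x = 0 := by
  obtain ⟨r, hr⟩ := LinearDynamics.exists_enum_rootsOfUnity
  obtain ⟨f, hf⟩ := LinearDynamics.exists_eigenvalues r
  exact ⟨LinearDynamics.bidiagonal hr hf, LinearDynamics.isHypercyclic_bidiagonal hr hf,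
    LinearDynamics.dense_uRec_bidiagonal hr hf,
    fun x hx => LinearDynamics.eq_zero_of_mem_periodicPts _
      (fun _ _ hp hμ _ h => LinearDynamics.bidiagonal_eigenvector_eq_zero hr hf hp hμ h) hx⟩
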